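/- Let $(X,\|\cdot\|)$ be a reflexive real Banach space whose norm is Gâteaux differentiable at every nonzero point, with dual $(X^*,\|\cdot\|_*)$ and duality mapping $J(x)=\{x^*\in X^*: \langle x^*,x\rangle=\|x\|^2=\|x^*\|_*^2\}$. For a set-valued mapping $T:X\rightrightarrows X^*$ write $\operatorname{gph}T=\{(x,x^*):x^*\in T(x)\}$. Fix $\sigma>0$. **Definitions.** $T$ is *monotone* if $\langle x_1^*-x_2^*,x_1-x_2\rangle\ge 0$ for all $(x_i,x_i^*)\in\operatorname{gph}T$. It is *$\sigma$-strongly monotone* if $\langle x_1^*-x_2^*,x_1-x_2\rangle\ge\sigma\langle j_1-j_2,x_1-x_2\rangle$ for all $(x_i,x_i^*)\in\operatorname{gph}T$ and $j_i\in J(x_i)$. It is *$\sigma$-strongly maximal monotone* if it is $\sigma$-strongly monotone and $\operatorname{gph}T=\operatorname{gph}S$ for every $\sigma$-strongly monotone $S$ with $\operatorname{gph}T\subset\operatorname{gph}S$. For $W\subset X\times X^*$, $T$ is *($\sigma$-strongly) monotone with respect to $W$* if there is a globally ($\sigma$-strongly) monotone $\bar T$ with $\operatorname{gph}\bar T\cap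 W=\operatorname{gph}T\cap W$. $T$ is *$\sigma$-strongly maximal monotone of type (A) with respect to $W$* if it is $\sigma$-strongly monotone with respect to $W$ and $\operatorname{gph}T\cap W=\operatorname{gph}S\cap W$ for every $S:X\rightrightarrows X^*$ that is monotone with respect to $W$ and satisfies $\operatorname{gph}T\cap W\subset\operatorname{gph}S\cap W$. Let $(\bar x,\bar x^*)\in\operatorname{gph}T$. Around $(\bar x,\bar x^*)$, with modulus $\sigma$, we say that - $T$ is *locally strongly monotone* if $T$ is $\sigma$-strongly monotone with respect to $U\times V$ for some open sets $U\ni\bar x$, $V\ni\bar x^*$; - $T$ is *locally strongly maximal monotone of type (A)* if $T$ is $\sigma$-strongly maximal monotone of type (A) with respect to some open neighborhood $W\subset X\times X^*$ of $(\bar x,\bar x^*)$; it is so *on a rectangle* if $W$ can be chosen of the form $U\times V$ with $U,V$ open; - $T$ is *locally strongly maximal monotone of type (B)* if there are open $U\ni\bar x$, $V\ni\bar x^*$ and a $\sigma$-strongly maximal monotone $\bar T$ with $\operatorname{gph}\bar T\cap(U\times V)=\operatorname{gph}T\cap(U\times V)$. The inverse $T^{-1}$ has a *continuous single-valued localization*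 around $(\bar x^*,\bar x)$ if there are open $V\ni\bar x^*$, $U\ni\bar x$ such that $\operatorname{gph}T^{-1}\cap(V\times U)$ is the graph of a (norm-to-norm) continuous function defined on all of $V$. **Theorem.** Consider the assertions: (i) $T$ is locally strongly maximal monotone of type (B) around $(\bar x,\bar x^*)$ with modulus $\sigma$; (ii) $T$ is locally strongly monotone around $(\bar x,\bar x^*)$ with modulus $\sigma$ and $T^{-1}$ has a continuous single-valued localization around $(\bar x^*,\bar x)$; (iii) $T$ is locally strongly maximal monotone of type (A) around $(\bar x,\bar x^*)$ with modulus $\sigma$; (iii$'$) as (iii), on a rectangle. Then (i) $\Longleftrightarrow$ (iii), and (iii$'$) $\Longrightarrow$ (i). If moreover the norm is Fréchet differentiable at every nonzero point, strictly convex, and Kadec–Klee ($x_k\to x$ weakly and $\|x_k\|\to\|x\|$ imply $\|x_k-x\|\to0$ for every sequence $(x_k)$), then also (i) $\Longleftrightarrow$ (ii) and (i) $\Longleftrightarrow$ (iii$'$), so that all four assertions are equivalent. -/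

import Mathlib

open Filter Topology

namespace LocMono

/-- The graph of a set-valued mapping. -/
def gph {Y Z : Type*} (F : Y → Set Z) : Set (Y × Z) := {p | p.2 ∈ F p.1}

/-- The inverse of a set-valued mapping. -/
def inv {Y Z : Type*} (F : Y → Set Z) : Z → Set Y := fun z => {y | z ∈ F y}

/-- `F` has a continuous single-valued localization around `(y₀, z₀)`: on some open rectangle
`U × V` containing the point, the graph of `F` is the graph of a continuous function that is
defined on all of `U`. -/
def HasContinuousSingleValuedLocalization {Y Z : Type*} [TopologicalSpace Y] [TopologicalSpace Z]
    (F : Y → Set Z) (y₀ : Y) (z₀ : Z) : Prop :=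
  ∃ (U : Set Y) (V : Set Z) (f : Y → Z), IsOpen U ∧ IsOpen V ∧ y₀ ∈ U ∧ z₀ ∈ V ∧
    ContinuousOn f U ∧ gph F ∩ U ×ˢ V = {p | p.1 ∈ U ∧ p.2 = f p.1}

section Geometry

variable (X : Type*) [NormedAddCommGroup X] [NormedSpace ℝ X]

/-- Reflexivity: the canonical embedding into the bidual is onto. -/
def IsReflexiveSpace : Prop :=
  Function.Surjective (NormedSpace.inclusionInDoubleDual ℝ X)

/-- The norm is Gâteaux differentiable at every nonzero point. -/
def GateauxSmooth : Prop :=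
  ∀ x : X, x ≠ 0 → ∃ f : StrongDual ℝ X, ∀ h : X,
    HasLineDerivAt ℝ (fun y : X => ‖y‖) (f h) x h

/-- The norm is Fréchet differentiable at every nonzero point. -/
def FrechetSmooth : Prop :=
  ∀ x : X, x ≠ 0 → DifferentiableAt ℝ (fun y : X => ‖y‖) x

/-- Kadec–Klee property: a weakly convergent sequence whose norms converge to the norm of the
weak limit converges in norm. -/
def KadecKlee : Prop :=
  ∀ (u : ℕ → X) (x : X),
    (∀ f : StrongDual ℝ X, Tendsto (fun k => f (u k)) atTop (𝓝 (f x))) →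
    Tendsto (fun k => ‖u k‖) atTop (𝓝 ‖x‖) → Tendsto u atTop (𝓝 x)

end Geometry

section Monotonicity

variable {X : Type*} [NormedAddCommGroup X] [NormedSpace ℝ X]

/-- The duality mapping `J(x) = {x* | ⟨x*, x⟩ = ‖x‖² = ‖x*‖²}`. -/
def dualityMap (x : X) : Set (StrongDual ℝ X) :=
  {f | f x = ‖x‖ ^ 2 ∧ ‖x‖ ^ 2 = ‖f‖ ^ 2}

/-- Global monotonicity. -/
def IsMonotone (T : X → Set (StrongDual ℝ X)) : Prop :=
  ∀ p ∈ gph T, ∀ q ∈ gph T, 0 ≤ (p.2 - q.2) (p.1 - q.1)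

/-- Global strong monotonicity with modulus `σ`, with respect to the duality mapping. -/
def IsStronglyMonotone (σ : ℝ) (T : X → Set (StrongDual ℝ X)) : Prop :=
  ∀ p ∈ gph T, ∀ q ∈ gph T, ∀ j₁ ∈ dualityMap p.1, ∀ j₂ ∈ dualityMap q.1,
    σ * (j₁ - j₂) (p.1 - q.1) ≤ (p.2 - q.2) (p.1 - q.1)

/-- `T` is `σ`-strongly monotone and has no proper `σ`-strongly monotone extension. -/
def IsStronglyMaximalMonotone (σ : ℝ) (T : X → Set (StrongDual ℝ X)) : Prop :=
  IsStronglyMonotone σ T ∧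
    ∀ S : X → Set (StrongDual ℝ X), IsStronglyMonotone σ S → gph T ⊆ gph S → gph T = gph S

/-- Monotonicity of `T` with respect to a set `W`: on `W`, the graph of `T` is that of some
globally monotone operator. -/
def IsMonotoneOn (T : X → Set (StrongDual ℝ X)) (W : Set (X × StrongDual ℝ X)) : Prop :=
  ∃ T' : X → Set (StrongDual ℝ X), IsMonotone T' ∧ gph T' ∩ W = gph T ∩ W

/-- `σ`-strong monotonicity of `T` with respect to a set `W`. -/
def IsStronglyMonotoneOn (σ : ℝ) (T : X → Set (StrongDual ℝ X))
    (W : Set (X × StrongDual ℝ X)) : Prop :=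
  ∃ T' : X → Set (StrongDual ℝ X), IsStronglyMonotone σ T' ∧ gph T' ∩ W = gph T ∩ W

/-- Strong maximal monotonicity of type (A) with respect to a set `W`: the competitors `S` are
only required to be monotone with respect to `W`. -/
def IsStronglyMaximalMonotoneOnA (σ : ℝ) (T : X → Set (StrongDual ℝ X))
    (W : Set (X × StrongDual ℝ X)) : Prop :=
  IsStronglyMonotoneOn σ T W ∧
    ∀ S : X → Set (StrongDual ℝ X), IsMonotoneOn S W →
      gph T ∩ W ⊆ gph S ∩ W → gph T ∩ W = gph S ∩ W

/-- Local strong monotonicity with modulus `σ` around `(x, x')`. -/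
def LocallyStronglyMonotone (σ : ℝ) (T : X → Set (StrongDual ℝ X))
    (x : X) (x' : StrongDual ℝ X) : Prop :=
  ∃ (U : Set X) (V : Set (StrongDual ℝ X)), IsOpen U ∧ IsOpen V ∧ x ∈ U ∧ x' ∈ V ∧
    IsStronglyMonotoneOn σ T (U ×ˢ V)

/-- Local strong maximal monotonicity of type (A) with modulus `σ` around `(x, x')`, witnessed by
an open neighborhood `W` of the point in the product space. -/
def LocallyStronglyMaximalMonotoneA (σ : ℝ) (T : X → Set (StrongDual ℝ X))
    (x : X) (x' : StrongDual ℝ X) : Prop :=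
  ∃ W : Set (X × StrongDual ℝ X), IsOpen W ∧ (x, x') ∈ W ∧ IsStronglyMaximalMonotoneOnA σ T W

/-- The variant of type (A) in which the witnessing neighborhood is a rectangle `U × V`. -/
def LocallyStronglyMaximalMonotoneARect (σ : ℝ) (T : X → Set (StrongDual ℝ X))
    (x : X) (x' : StrongDual ℝ X) : Prop :=
  ∃ (U : Set X) (V : Set (StrongDual ℝ X)), IsOpen U ∧ IsOpen V ∧ x ∈ U ∧ x' ∈ V ∧
    IsStronglyMaximalMonotoneOnA σ T (U ×ˢ V)

/-- Local strong maximal monotonicity of type (B) with modulus `σ` around `(x, x')`: near the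
point, the graph of `T` is that of a globally `σ`-strongly maximal monotone operator. -/
def LocallyStronglyMaximalMonotoneB (σ : ℝ) (T : X → Set (StrongDual ℝ X))
    (x : X) (x' : StrongDual ℝ X) : Prop :=
  ∃ (U : Set X) (V : Set (StrongDual ℝ X)), IsOpen U ∧ IsOpen V ∧ x ∈ U ∧ x' ∈ V ∧
    ∃ T' : X → Set (StrongDual ℝ X),
      IsStronglyMaximalMonotone σ T' ∧ gph T' ∩ U ×ˢ V = gph T ∩ U ×ˢ V

end Monotonicity

end LocMono

/-! Everything passes through a globally σ-strongly maximal monotone extension T' of the local piece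
of T. Subtracting σJ from T' leaves a maximal monotone operator, so Rockafellar's theorem
(`exists_mem_add_duality_eq_zero`) makes T' and all its resolvent equations solvable.

For (B) ⇒ (A), a point w of a monotone competitor is compared with its resolvent point q on T'. If w
is close to the graph, q stays in the good rectangle (`IsMonotone.resolvent_mem_of_nhds`), hence
lies in the competitor too; monotonicity then makes the squared distance from w to q nonpositive.
The converse is Zorn's lemma: the maximal extension of the local witness is itself a competitor.

With strict convexity and Kadec–Klee, strong monotonicity makes the inverse of T' a continuous map
on the whole dual. Pulling U back along it gives the localization and the rectangle for type (A).
Conversely, Minty's argument (`eq_of_monotone_related`) shows that a continuous localization admits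
no additional monotonically related point. -/

namespace LocMono

/-! ### Convex separation -/

/-- **Sandwich theorem.** A convex set in `E × ℝ` lying above the graph of a continuous concave
function `-g` is separated from it by the graph of a continuous affine function. -/
theorem exists_affine_between {E : Type*} [NormedAddCommGroup E] [NormedSpace ℝ E]
    {K : Set (E × ℝ)} {g : E → ℝ} (hK : Convex ℝ K) (hne : K.Nonempty)
    (hg : ConvexOn ℝ Set.univ g) (hgc : Continuous g) (hle : ∀ p ∈ K, -g p.1 ≤ p.2) :
    ∃ (l : StrongDual ℝ E) (c : ℝ), (∀ p ∈ K, l p.1 + c ≤ p.2) ∧ ∀ e, -g e ≤ l e + c := by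
  set A : Set (E × ℝ) := {p | p.2 < -g p.1} with hA
  have hAo : IsOpen A := isOpen_lt continuous_snd (hgc.comp continuous_fst).neg
  have hAc : Convex ℝ A := by
    intro p hp q hq a b ha hb hab
    have h1 := hg.2 (Set.mem_univ p.1) (Set.mem_univ q.1) ha hb hab
    simp only [hA, Set.mem_ofPred_eq, Prod.snd_add, Prod.fst_add, Prod.smul_fst, Prod.smul_snd,
      smul_eq_mul] at hp hq h1 ⊢
    rcases ha.eq_or_lt with rfl | ha'
    · have : b = 1 := by linarith
      subst this
      simpa using hq
    · have h2 := mul_lt_mul_of_pos_left hp ha'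
      have h3 := mul_le_mul_of_nonneg_left hq.le hb
      linarith
  have hdis : Disjoint A K := by
    rw [Set.disjoint_left]
    intro p hp hpK
    exact absurd (hle p hpK) (not_le.mpr hp)
  obtain ⟨f, u, hfA, hfK⟩ := geometric_hahn_banach_open hAc hAo hK hdis
  set t : ℝ := f (0, 1) with ht
  have hf : ∀ e r, f (e, r) = f (e, 0) + r * t := by
    intro e r
    have : ((e, r) : E × ℝ) = (e, 0) + r • (0, 1) := by simp
    rw [this, map_add, map_smul, smul_eq_mul]
  obtain ⟨k, hk⟩ := hne
  -- The separating hyperplane is not vertical: as `g` is finite everywhere, `A` has a point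
  -- directly below any point of `K`.
  have htpos : 0 < t := by
    have h1 := hfK k hk
    have h2 := hfA (k.1, -g k.1 - 1) (by simp [hA])
    have h3 : f k = f (k.1, 0) + k.2 * t := hf k.1 k.2
    rw [hf] at h2
    have h4 := hle k hk
    by_contra hneg
    push Not at hneg
    nlinarith
  have hlim : ∀ e, f (e, 0) - g e * t ≤ u := by
    intro e
    refine le_of_forall_pos_le_add fun ε hε => ?_
    have h1 := hfA (e, -g e - ε / t) (by simp only [hA, Set.mem_ofPred_eq]; linarith [div_pos hε htpos])
    rw [hf] at h1
    have : ε / t * t = ε := div_mul_cancel₀ _ htpos.ne'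
    nlinarith
  refine ⟨-(t⁻¹ • f.comp (ContinuousLinearMap.inl ℝ E ℝ)), t⁻¹ * u, ?_, ?_⟩
  · intro p hp
    have h1 := hfK p hp
    have h3 : f p = f (p.1, 0) + p.2 * t := hf p.1 p.2
    have h4 : t⁻¹ * (u - f (p.1, 0)) ≤ p.2 := by
      rw [inv_mul_le_iff₀ htpos]
      linarith
    simp only [neg_apply, smul_apply,
      ContinuousLinearMap.comp_apply, ContinuousLinearMap.inl_apply, smul_eq_mul]
    linarith
  · intro e
    have h4 : -g e ≤ t⁻¹ * (u - f (e, 0)) := by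
      rw [le_inv_mul_iff₀ htpos]
      linarith [hlim e]
    simp only [neg_apply, smul_apply,
      ContinuousLinearMap.comp_apply, ContinuousLinearMap.inl_apply, smul_eq_mul]
    linarith

theorem convexOn_norm_add_sq {E F : Type*} [NormedAddCommGroup E] [NormedSpace ℝ E]
    [NormedAddCommGroup F] [NormedSpace ℝ F] (A : E →L[ℝ] F) (b : F) {c : ℝ} (hc : 0 ≤ c) :
    ConvexOn ℝ Set.univ fun e => c * ‖A e + b‖ ^ 2 := by
  refine ⟨convex_univ, fun p _ q _ s t hs ht hst => ?_⟩
  have h1 : A (s • p + t • q) + b = s • (A p + b) + t • (A q + b) := by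
    have : b = (s + t) • b := by rw [hst, one_smul]
    rw [map_add, map_smul, map_smul, smul_add, smul_add]
    nth_rewrite 1 [this]
    rw [add_smul]
    abel
  have h2 : ‖s • (A p + b) + t • (A q + b)‖ ≤ s * ‖A p + b‖ + t * ‖A q + b‖ := by
    refine (norm_add_le _ _).trans ?_
    rw [norm_smul, norm_smul, Real.norm_of_nonneg hs, Real.norm_of_nonneg ht]
  simp only [smul_eq_mul]
  rw [h1]
  have h3 : ‖s • (A p + b) + t • (A q + b)‖ ^ 2 ≤ s * ‖A p + b‖ ^ 2 + t * ‖A q + b‖ ^ 2 := by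
    refine (pow_le_pow_left₀ (norm_nonneg _) h2 2).trans ?_
    have : t = 1 - s := by linarith
    subst this
    nlinarith [mul_nonneg (mul_nonneg hs ht) (sq_nonneg (‖A p + b‖ - ‖A q + b‖))]
  nlinarith

/-! ### The duality mapping -/

section Duality

variable {X : Type*} [NormedAddCommGroup X] [NormedSpace ℝ X]

theorem exists_mem_dualityMap (x : X) : ∃ j, j ∈ dualityMap x := by
  by_cases hx : x = 0
  · exact ⟨0, by simp [dualityMap, hx]⟩
  obtain ⟨g, hg, hgx⟩ := exists_dual_vector ℝ x (norm_ne_zero_iff.mpr hx)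
  refine ⟨‖x‖ • g, ?_, ?_⟩
  · simp only [smul_apply, smul_eq_mul, hgx, RCLike.ofReal_real_eq_id, id]
    ring
  · rw [norm_smul, norm_norm, hg, mul_one]

theorem norm_eq_of_mem_dualityMap {x : X} {j : StrongDual ℝ X} (hj : j ∈ dualityMap x) :
    ‖j‖ = ‖x‖ :=
  ((pow_left_inj₀ (norm_nonneg _) (norm_nonneg _) two_ne_zero).mp hj.2).symm

theorem apply_le_of_mem_dualityMap {x : X} {j : StrongDual ℝ X} (hj : j ∈ dualityMap x) (y : X) :
    j y ≤ ‖x‖ * ‖y‖ := by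
  rw [← norm_eq_of_mem_dualityMap hj]
  exact (le_abs_self _).trans (j.le_opNorm y)

/-- All three summands are nonnegative. This gives monotonicity of J, and later lets strong
monotonicity control both the norms and the defect in the support inequality. -/
theorem sub_apply_sub_of_mem_dualityMap {x y : X} {j k : StrongDual ℝ X} (hj : j ∈ dualityMap x)
    (hk : k ∈ dualityMap y) :
    (j - k) (x - y) = (‖x‖ - ‖y‖) ^ 2 + (‖x‖ * ‖y‖ - j y) + (‖y‖ * ‖x‖ - k x) := by
  have h1 := hj.1
  have h2 := hk.1
  simp only [sub_apply, map_sub, h1, h2]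
  ring

theorem dualityMap_monotone {x y : X} {j k : StrongDual ℝ X} (hj : j ∈ dualityMap x)
    (hk : k ∈ dualityMap y) : 0 ≤ (j - k) (x - y) := by
  rw [sub_apply_sub_of_mem_dualityMap hj hk]
  linarith [sq_nonneg (‖x‖ - ‖y‖), apply_le_of_mem_dualityMap hj y,
    apply_le_of_mem_dualityMap hk x]

/-- J is the gradient of half the squared norm: ‖p‖‖·‖ - j is nonnegative and vanishes at p, so
Fermat's rule identifies ‖p‖ times the derivative of the norm with j. At the origin the function is
quadratic in t. -/
theorem GateauxSmooth.hasDerivAt (hX : GateauxSmooth X) {p : X} {j : StrongDual ℝ X}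
    (hj : j ∈ dualityMap p) (h : X) :
    HasDerivAt (fun t : ℝ => ‖p + t • h‖ ^ 2 / 2) (j h) 0 := by
  by_cases hp : p = 0
  · subst hp
    have hj0 : j = 0 := by
      have := norm_eq_of_mem_dualityMap hj
      rwa [norm_zero, norm_eq_zero] at this
    subst hj0
    have h1 : HasDerivAt (fun t : ℝ => t ^ 2 * (‖h‖ ^ 2 / 2))
        ((2 : ℕ) * (0 : ℝ) ^ (2 - 1) * (‖h‖ ^ 2 / 2)) 0 :=
      (hasDerivAt_pow 2 (0 : ℝ)).mul_const _
    convert h1 using 1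
    · funext t
      rw [zero_add, norm_smul, mul_pow, Real.norm_eq_abs, sq_abs]
      ring
    · simp
  · obtain ⟨f, hf⟩ := hX p hp
    have hd : HasDerivAt (fun t : ℝ => ‖p + t • h‖) (f h) 0 := hf h
    have hlin : HasDerivAt (fun t : ℝ => j (p + t • h)) (j h) 0 := by
      have : HasDerivAt (fun t : ℝ => j p + t * j h) (1 * j h) 0 :=
        ((hasDerivAt_id (0 : ℝ)).mul_const _).const_add _
      simpa using this
    have hmin : IsLocalMin (fun t : ℝ => ‖p‖ * ‖p + t • h‖ - j (p + t • h)) 0 := by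
      refine Eventually.of_forall fun t => ?_
      have h1 := apply_le_of_mem_dualityMap hj (p + t • h)
      have h2 := hj.1
      simp only [zero_smul, add_zero, h2]
      linarith
    have h0 := hmin.hasDerivAt_eq_zero ((hd.const_mul ‖p‖).sub hlin)
    have h2 := (hd.pow 2).div_const 2
    refine h2.congr_deriv ?_
    norm_num
    linarith

theorem GateauxSmooth.dualityMap_subsingleton (hX : GateauxSmooth X) {p : X}
    {j k : StrongDual ℝ X} (hj : j ∈ dualityMap p) (hk : k ∈ dualityMap p) : j = k :=
  ContinuousLinearMap.ext fun h => (hX.hasDerivAt hj h).unique (hX.hasDerivAt hk h)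

end Duality

/-! ### Surjectivity, resolvents and maximal extensions -/

variable {X : Type*} [NormedAddCommGroup X] [NormedSpace ℝ X]

/-- **Rockafellar's surjectivity theorem**, with two duality terms centred at `0` and at `x`. The
proof separates the epigraph of the Fitzpatrick function of `M` from the quadratic terms. -/
theorem exists_mem_add_duality_eq_zero (hrefl : IsReflexiveSpace X) (hsmooth : GateauxSmooth X)
    {J : X → StrongDual ℝ X} (hJ : ∀ p, J p ∈ dualityMap p) {M : Set (X × StrongDual ℝ X)}
    (hmono : ∀ p ∈ M, ∀ q ∈ M, 0 ≤ (p.2 - q.2) (p.1 - q.1))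
    (hmax : ∀ p w, (∀ q ∈ M, 0 ≤ (q.2 - w) (q.1 - p)) → (p, w) ∈ M)
    {a b : ℝ} (ha : 0 < a) (hb : 0 < b) (x : X) :
    ∃ z m, (z, m) ∈ M ∧ m + a • J z + b • J (z - x) = 0 := by
  -- Each quadratic term is paired with its conjugate in its own dual variable, u or v.
  -- Fenchel–Young then gives g(z,u,v) ≥ (u+v)z (`hglow`), with equality at the duality images of p
  -- (`hgJ`).
  set g : X × StrongDual ℝ X × StrongDual ℝ X → ℝ := fun e =>
    a / 2 * ‖e.1‖ ^ 2 + b / 2 * ‖e.1 - x‖ ^ 2 + (2 * a)⁻¹ * ‖e.2.1‖ ^ 2 +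
      (2 * b)⁻¹ * ‖e.2.2‖ ^ 2 + e.2.2 x with hgdef
  have hgc : Continuous g := by fun_prop
  have hg : ConvexOn ℝ Set.univ g := by
    have h1 := convexOn_norm_add_sq
      (ContinuousLinearMap.fst ℝ X (StrongDual ℝ X × StrongDual ℝ X)) 0 (half_pos ha).le
    have h2 := convexOn_norm_add_sq
      (ContinuousLinearMap.fst ℝ X (StrongDual ℝ X × StrongDual ℝ X)) (-x) (half_pos hb).le
    have h3 := convexOn_norm_add_sq ((ContinuousLinearMap.fst ℝ _ _).comp
      (ContinuousLinearMap.snd ℝ X (StrongDual ℝ X × StrongDual ℝ X))) 0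
      (inv_pos.mpr (mul_pos two_pos ha)).le
    have h4 := convexOn_norm_add_sq ((ContinuousLinearMap.snd ℝ _ _).comp
      (ContinuousLinearMap.snd ℝ X (StrongDual ℝ X × StrongDual ℝ X))) 0
      (inv_pos.mpr (mul_pos two_pos hb)).le
    have h5 : ConvexOn ℝ Set.univ
        fun e : X × StrongDual ℝ X × StrongDual ℝ X => e.2.2 x :=
      ⟨convex_univ, fun p _ q _ s t _ _ _ => by simp⟩
    refine ((((h1.add h2).add h3).add h4).add h5).congr fun e _ => ?_
    simp [hgdef, sub_eq_add_neg]
  have hgJ : ∀ p, g (p, a • J p, b • J (p - x)) = a * J p p + b * J (p - x) p := by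
    intro p
    have h1 := (hJ p).1
    have h2 := (hJ (p - x)).1
    have h3 : J (p - x) p = J (p - x) (p - x) + J (p - x) x := by rw [← map_add, sub_add_cancel]
    simp only [hgdef, norm_smul, norm_eq_of_mem_dualityMap (hJ _), Real.norm_of_nonneg ha.le,
      Real.norm_of_nonneg hb.le, smul_apply, smul_eq_mul, h3, h1, h2]
    field_simp
    ring
  have hglow : ∀ z u v, (u + v) z ≤ g (z, u, v) := by
    intro z u v
    have h1 : u z ≤ a / 2 * ‖z‖ ^ 2 + (2 * a)⁻¹ * ‖u‖ ^ 2 := by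
      have h := (le_abs_self _).trans (u.le_opNorm z)
      have h' : a / 2 * ‖z‖ ^ 2 + (2 * a)⁻¹ * ‖u‖ ^ 2 - ‖u‖ * ‖z‖
          = (2 * a)⁻¹ * (a * ‖z‖ - ‖u‖) ^ 2 := by field_simp; ring
      have : 0 ≤ (2 * a)⁻¹ * (a * ‖z‖ - ‖u‖) ^ 2 := by positivity
      linarith
    have h2 : v (z - x) ≤ b / 2 * ‖z - x‖ ^ 2 + (2 * b)⁻¹ * ‖v‖ ^ 2 := by
      have h := (le_abs_self _).trans (v.le_opNorm (z - x))
      have h' : b / 2 * ‖z - x‖ ^ 2 + (2 * b)⁻¹ * ‖v‖ ^ 2 - ‖v‖ * ‖z - x‖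
          = (2 * b)⁻¹ * (b * ‖z - x‖ - ‖v‖) ^ 2 := by field_simp; ring
      have : 0 ≤ (2 * b)⁻¹ * (b * ‖z - x‖ - ‖v‖) ^ 2 := by positivity
      linarith
    rw [map_sub] at h2
    simp only [hgdef, add_apply]
    linarith
  -- The epigraph of (z,u,v) ↦ F(z,-u-v), with F the Fitzpatrick function of `M`. Maximality gives
  -- F(z,w) ≥ w z, hence `hle`.
  set K : Set ((X × StrongDual ℝ X × StrongDual ℝ X) × ℝ) :=
    {e | ∀ q ∈ M, (-e.1.2.1 - e.1.2.2) q.1 + q.2 e.1.1 - q.2 q.1 ≤ e.2} with hKdef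
  have hKmem : ∀ q ∈ M, ∀ u v, -u - v = q.2 → ((q.1, u, v), q.2 q.1) ∈ K := by
    intro q hq u v huv r hr
    have := hmono q hq r hr
    simp only [huv]
    simp only [sub_apply, map_sub] at this
    linarith
  have hK : Convex ℝ K := by
    intro p hp r hr s t hs ht hst q hq
    have h1 := mul_le_mul_of_nonneg_left (hp q hq) hs
    have h2 := mul_le_mul_of_nonneg_left (hr q hq) ht
    have h3 : q.2 q.1 = s * q.2 q.1 + t * q.2 q.1 := by rw [← add_mul, hst, one_mul]
    simp only [Prod.fst_add, Prod.snd_add, Prod.smul_fst, Prod.smul_snd, map_add, map_smul,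
      add_apply, smul_apply, sub_apply, neg_apply, smul_eq_mul] at h1 h2 ⊢
    linarith
  have hMne : M.Nonempty := by
    by_contra h
    rw [Set.not_nonempty_iff_eq_empty] at h
    have h0 := hmax 0 0 (by simp [h])
    simp [h] at h0
  have hKne : K.Nonempty := by
    obtain ⟨q, hq⟩ := hMne
    exact ⟨_, hKmem q hq 0 (-q.2) (by simp)⟩
  have hle : ∀ p ∈ K, -g p.1 ≤ p.2 := by
    rintro ⟨⟨z, u, v⟩, r⟩ hr
    have h1 := hglow z u v
    suffices h : -((u + v) z) ≤ r by simp only; linarith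
    by_cases hz : (z, -u - v) ∈ M
    · have h2 := hr _ hz
      simp only [sub_apply, neg_apply, add_apply] at h2 ⊢
      linarith
    · have h2 := mt (hmax z (-u - v)) hz
      push Not at h2
      obtain ⟨q, hq, h3⟩ := h2
      have h4 := hr q hq
      simp only [sub_apply, neg_apply, add_apply, map_sub] at h3 h4 ⊢
      linarith
  obtain ⟨l, c, hlK, hlg⟩ := exists_affine_between hK hKne hg hgc hle
  set w : StrongDual ℝ X := l.comp (ContinuousLinearMap.inl ℝ X _) with hw
  obtain ⟨p₁, hp₁⟩ := hrefl ((l.comp (ContinuousLinearMap.inr ℝ X _)).comp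
    (ContinuousLinearMap.inl ℝ _ _))
  obtain ⟨p₂, hp₂⟩ := hrefl ((l.comp (ContinuousLinearMap.inr ℝ X _)).comp
    (ContinuousLinearMap.inr ℝ _ _))
  have hl : ∀ z u v, l (z, u, v) = w z + u p₁ + v p₂ := by
    intro z u v
    have h1 : u p₁ = l (0, u, 0) := by
      rw [← NormedSpace.dual_def ℝ X p₁ u, hp₁]; simp
    have h2 : v p₂ = l (0, 0, v) := by
      rw [← NormedSpace.dual_def ℝ X p₂ v, hp₂]; simp
    rw [h1, h2, hw]
    simp [← map_add]
  -- `K` sees only u + v, so it is invariant under (u,v) ↦ (u+tf, v-tf); an affine minorant must be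
  -- constant in that direction.
  have hp : p₁ = p₂ := by
    obtain ⟨q, hq⟩ := hMne
    refine sub_eq_zero.mp ((SeparatingDual.eq_zero_iff_forall_dual_eq_zero (R := ℝ) _).mpr fun f => ?_)
    have key : ∀ t : ℝ, t * f (p₁ - p₂) ≤ q.2 q.1 - c - w q.1 + q.2 p₂ := by
      intro t
      have h := hlK _ (hKmem q hq (t • f) (-q.2 - t • f) (by abel))
      simp only [hl, sub_apply, neg_apply, smul_apply, smul_eq_mul] at h
      rw [map_sub]
      linarith
    by_contra hne
    have h := key ((q.2 q.1 - c - w q.1 + q.2 p₂ + 1) / f (p₁ - p₂))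
    rw [div_mul_cancel₀ _ hne] at h
    linarith
  subst hp
  set p : X := -p₁ with hpdef
  have hp₁' : p₁ = -p := by simp [hpdef]
  have hM : ∀ q ∈ M, w q.1 + q.2 p + c ≤ q.2 q.1 := by
    intro q hq
    have h := hlK _ (hKmem q hq 0 (-q.2) (by simp))
    simp only [hl, hp₁', map_neg, neg_apply, zero_apply] at h
    linarith
  have hG : ∀ z u v, 0 ≤ g (z, u, v) + w z - (u + v) p + c := by
    intro z u v
    have h := hlg (z, u, v)
    simp only [hl, hp₁', map_neg] at h
    rw [add_apply]
    linarith
  -- The affine bound is evaluated at the equality case of Fenchel–Young. Combined with `hM` it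
  -- makes (p,w) monotonically related to `M`.
  have hc : -w p ≤ c := by
    have h := hG p (a • J p) (b • J (p - x))
    rw [hgJ] at h
    simp only [add_apply, smul_apply, smul_eq_mul] at h
    linarith
  have hpw : (p, w) ∈ M := by
    refine hmax p w fun q hq => ?_
    have h := hM q hq
    simp only [sub_apply, map_sub]
    linarith
  refine ⟨p, w, hpw, ?_⟩
  have hc' : c ≤ -w p := by linarith [hM _ hpw]
  ext h
  have hd1 := (hsmooth.hasDerivAt (hJ p) h).const_mul a
  have hd2 := (hsmooth.hasDerivAt (hJ (p - x)) h).const_mul b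
  have hd3 : HasDerivAt (fun t : ℝ => w (p + t • h)) (w h) 0 := by
    have : HasDerivAt (fun t : ℝ => w p + t * w h) (1 * w h) 0 :=
      ((hasDerivAt_id (0 : ℝ)).mul_const _).const_add _
    simpa using this
  -- With c = -w p and the dual variables frozen, `hG` says that p minimizes w + a‖·‖²/2 +
  -- b‖·-x‖²/2; the critical point equation is the claim.
  have hmin : IsLocalMin (fun t : ℝ => w (p + t • h) + a * (‖p + t • h‖ ^ 2 / 2) +
      b * (‖p - x + t • h‖ ^ 2 / 2)) 0 := by
    refine Eventually.of_forall fun t => ?_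
    have h1 := hG (p + t • h) (a • J p) (b • J (p - x))
    have h2 := hgJ p
    have h3 : p - x + t • h = p + t • h - x := by abel
    simp only [hgdef, add_apply, smul_apply, smul_eq_mul] at h1 h2
    simp only [zero_smul, add_zero, h3]
    linarith
  have h0 := hmin.hasDerivAt_eq_zero ((hd3.add hd1).add hd2)
  simpa using h0

/-- The graph of a strongly maximal monotone operator contains every point to which it is
strongly monotonically related. -/
theorem IsStronglyMaximalMonotone.mem_gph (hsmooth : GateauxSmooth X) {σ : ℝ}
    {J : X → StrongDual ℝ X} (hJ : ∀ p, J p ∈ dualityMap p) {T : X → Set (StrongDual ℝ X)}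
    (hT : IsStronglyMaximalMonotone σ T) {p : X} {w : StrongDual ℝ X}
    (h : ∀ q ∈ gph T, σ * (J q.1 - J p) (q.1 - p) ≤ (q.2 - w) (q.1 - p)) : (p, w) ∈ gph T := by
  set S : X → Set (StrongDual ℝ X) := fun y => {f | f ∈ T y ∨ (y = p ∧ f = w)} with hS
  have key : IsStronglyMonotone σ S := by
    rintro ⟨y, f⟩ hy ⟨z, k⟩ hz j₁ hj₁ j₂ hj₂
    rcases hy with hy | ⟨rfl, rfl⟩ <;> rcases hz with hz | ⟨hz1, hz2⟩
    · exact hT.1 _ hy _ hz _ hj₁ _ hj₂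
    · simp only at hz1 hz2
      subst hz1 hz2
      have h1 := h _ hy
      rw [hsmooth.dualityMap_subsingleton hj₁ (hJ y), hsmooth.dualityMap_subsingleton hj₂ (hJ z)]
      exact h1
    · have h1 := h _ hz
      rw [hsmooth.dualityMap_subsingleton hj₁ (hJ y), hsmooth.dualityMap_subsingleton hj₂ (hJ z)]
      simp only [sub_apply, map_sub] at h1 ⊢
      linarith
    · simp only at hz1 hz2
      subst hz1 hz2
      simp
  have hsub : gph T ⊆ gph S := fun q hq => Or.inl hq
  rw [hT.2 S key hsub]
  exact Or.inr ⟨rfl, rfl⟩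

theorem IsStronglyMonotone.isMonotone {σ : ℝ} (hσ : 0 ≤ σ) {T : X → Set (StrongDual ℝ X)}
    (hT : IsStronglyMonotone σ T) : IsMonotone T := by
  intro p hp q hq
  obtain ⟨j, hj⟩ := exists_mem_dualityMap p.1
  obtain ⟨k, hk⟩ := exists_mem_dualityMap q.1
  exact (mul_nonneg hσ (dualityMap_monotone hj hk)).trans (hT p hp q hq j hj k hk)

/-- Rockafellar's theorem for the maximal monotone operator T - σJ - y. The choice a = σ, b = 1
cancels σJ and yields the resolvent; a = b = σ/2 with x = 0 cancels all duality terms and yields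
surjectivity. -/
theorem IsStronglyMaximalMonotone.exists_mem_add_duality_eq (hrefl : IsReflexiveSpace X)
    (hsmooth : GateauxSmooth X) {σ : ℝ} {J : X → StrongDual ℝ X} (hJ : ∀ p, J p ∈ dualityMap p)
    {T : X → Set (StrongDual ℝ X)} (hT : IsStronglyMaximalMonotone σ T) {a b : ℝ} (ha : 0 < a)
    (hb : 0 < b) (x : X) (y : StrongDual ℝ X) :
    ∃ z m, (z, m) ∈ gph T ∧ m - σ • J z + a • J z + b • J (z - x) = y := by
  set M : Set (X × StrongDual ℝ X) := {q | (q.1, q.2 + σ • J q.1 + y) ∈ gph T}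
  have hmono : ∀ p ∈ M, ∀ q ∈ M, 0 ≤ (p.2 - q.2) (p.1 - q.1) := by
    intro p hp q hq
    have h := hT.1 _ hp _ hq _ (hJ _) _ (hJ _)
    simp only [add_apply, sub_apply, smul_apply, smul_eq_mul] at h ⊢
    linarith
  have hmax : ∀ p w, (∀ q ∈ M, 0 ≤ (q.2 - w) (q.1 - p)) → (p, w) ∈ M := by
    intro p w h
    refine hT.mem_gph hsmooth hJ fun q hq => ?_
    have h1 := h (q.1, q.2 - σ • J q.1 - y) (by
      change (q.1, q.2 - σ • J q.1 - y + σ • J q.1 + y) ∈ gph T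
      rwa [show q.2 - σ • J q.1 - y + σ • J q.1 + y = q.2 by abel])
    simp only [add_apply, sub_apply, smul_apply, smul_eq_mul] at h1 ⊢
    linarith
  obtain ⟨z, m, hm, h⟩ := exists_mem_add_duality_eq_zero hrefl hsmooth hJ hmono hmax ha hb x
  refine ⟨z, _, hm, ?_⟩
  simp only
  rw [← sub_eq_zero, ← h]
  abel

/-- The resolvent of a strongly maximal monotone operator is everywhere defined. -/
theorem IsStronglyMaximalMonotone.exists_resolvent (hrefl : IsReflexiveSpace X)
    (hsmooth : GateauxSmooth X) {σ : ℝ} (hσ : 0 < σ) {T : X → Set (StrongDual ℝ X)}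
    (hT : IsStronglyMaximalMonotone σ T) (x : X) (y : StrongDual ℝ X) :
    ∃ z m, (z, m) ∈ gph T ∧ y - m ∈ dualityMap (z - x) := by
  choose J hJ using exists_mem_dualityMap (X := X)
  obtain ⟨z, m, hm, h⟩ := hT.exists_mem_add_duality_eq hrefl hsmooth hJ hσ one_pos x y
  refine ⟨z, m, hm, ?_⟩
  rw [← h]
  convert hJ (z - x) using 1
  rw [one_smul]
  abel

/-- A strongly maximal monotone operator is onto. -/
theorem IsStronglyMaximalMonotone.exists_mem_gph (hrefl : IsReflexiveSpace X)
    (hsmooth : GateauxSmooth X) {σ : ℝ} (hσ : 0 < σ) {T : X → Set (StrongDual ℝ X)}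
    (hT : IsStronglyMaximalMonotone σ T) (y : StrongDual ℝ X) : ∃ z, (z, y) ∈ gph T := by
  choose J hJ using exists_mem_dualityMap (X := X)
  obtain ⟨z, m, hm, h⟩ :=
    hT.exists_mem_add_duality_eq hrefl hsmooth hJ (half_pos hσ) (half_pos hσ) 0 y
  refine ⟨z, ?_⟩
  convert hm
  rw [← h, sub_zero, add_assoc, ← add_smul, add_halves, sub_add_cancel]

/-- Every strongly monotone operator has a strongly maximal monotone extension. -/
theorem IsStronglyMonotone.exists_maximal {σ : ℝ} {T : X → Set (StrongDual ℝ X)}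
    (hT : IsStronglyMonotone σ T) :
    ∃ T', IsStronglyMaximalMonotone σ T' ∧ gph T ⊆ gph T' := by
  have hchain : ∀ c ⊆ {G : Set (X × StrongDual ℝ X) |
      IsStronglyMonotone σ fun y => {f | (y, f) ∈ G}}, IsChain (· ⊆ ·) c → c.Nonempty →
      ∃ ub ∈ {G : Set (X × StrongDual ℝ X) | IsStronglyMonotone σ fun y => {f | (y, f) ∈ G}},
        ∀ s ∈ c, s ⊆ ub := by
    intro c hc hchain _
    refine ⟨⋃₀ c, ?_, fun s hs => Set.subset_sUnion_of_mem hs⟩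
    rintro p ⟨s, hs, hps⟩ q ⟨t, ht, hqt⟩
    rcases hchain.total hs ht with h | h
    · exact hc ht p (h hps) q hqt
    · exact hc hs p hps q (h hqt)
  obtain ⟨G, hTG, hG⟩ := zorn_subset_nonempty _ hchain (gph T) hT
  refine ⟨fun y => {f | (y, f) ∈ G}, ⟨hG.1, fun S hS hsub => ?_⟩, hTG⟩
  exact hsub.antisymm (hG.2 (y := gph S) hS hsub)

/-- The resolvent of a monotone operator is continuous at the points of its graph. -/
theorem IsMonotone.resolvent_mem_of_nhds {T : X → Set (StrongDual ℝ X)} (hT : IsMonotone T)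
    {p : X × StrongDual ℝ X} (hp : p ∈ gph T) {N : Set (X × StrongDual ℝ X)} (hN : N ∈ 𝓝 p) :
    ∀ᶠ w in 𝓝 p, ∀ q ∈ gph T, w.2 - q.2 ∈ dualityMap (q.1 - w.1) → q ∈ N := by
  obtain ⟨ε, hε, hball⟩ := Metric.mem_nhds_iff.mp hN
  refine Metric.eventually_nhds_iff.mpr ⟨ε / 5, by positivity, fun w hw q hq hj => hball ?_⟩
  set δ := ε / 5
  have hδ : 0 < δ := by positivity
  rw [Prod.dist_eq, max_lt_iff, dist_eq_norm, dist_eq_norm] at hw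
  obtain ⟨h1, h2⟩ := hw
  set j := w.2 - q.2 with hjdef
  set r := ‖q.1 - w.1‖ with hr
  have hr0 : 0 ≤ r := norm_nonneg _
  have hjn : ‖j‖ = r := norm_eq_of_mem_dualityMap hj
  have hm := hT q hq p hp
  have e1 : q.2 - p.2 = (w.2 - p.2) - j := by rw [hjdef]; abel
  have e2 : q.1 - p.1 = (q.1 - w.1) + (w.1 - p.1) := by abel
  have n1 : ‖q.1 - p.1‖ ≤ r + δ := by
    rw [e2]; exact (norm_add_le _ _).trans (by linarith)
  have n2 : ‖q.2 - p.2‖ ≤ δ + r := by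
    rw [e1]; exact (norm_sub_le _ _).trans (by linarith)
  have b1 : (w.2 - p.2) (q.1 - p.1) ≤ δ * (r + δ) :=
    (le_abs_self _).trans (((w.2 - p.2).le_opNorm _).trans
      (mul_le_mul h2.le n1 (norm_nonneg _) hδ.le))
  have b2 : -j (w.1 - p.1) ≤ r * δ :=
    (neg_le_abs _).trans ((j.le_opNorm _).trans
      (mul_le_mul hjn.le h1.le (norm_nonneg _) hr0))
  have b3 : j (q.1 - p.1) = r ^ 2 + j (w.1 - p.1) := by rw [e2, map_add, hj.1]
  -- Monotonicity gives r² ≤ 2δr + δ². Both components of q are then within 4δ < ε of p, whence the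
  -- factor 5.
  have hrδ : r ≤ 3 * δ := by
    rw [e1, sub_apply, b3] at hm
    by_contra h
    push Not at h
    nlinarith
  rw [Metric.mem_ball, Prod.dist_eq, max_lt_iff, dist_eq_norm, dist_eq_norm]
  have : ε = 5 * δ := by simp only [δ]; ring
  constructor <;> linarith

/-! ### Equivalence of types (A) and (B) -/

theorem LocallyStronglyMaximalMonotoneB.typeA (hrefl : IsReflexiveSpace X)
    (hsmooth : GateauxSmooth X) {σ : ℝ} (hσ : 0 < σ) {T : X → Set (StrongDual ℝ X)} {x : X}
    {x' : StrongDual ℝ X} (hx : (x, x') ∈ gph T) (h : LocallyStronglyMaximalMonotoneB σ T x x') :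
    LocallyStronglyMaximalMonotoneA σ T x x' := by
  obtain ⟨U, V, hU, hV, hxU, hxV, T', hT', heq⟩ := h
  have hmono := hT'.1.isMonotone hσ.le
  -- Points whose resolvent points on T' remain in the rectangle. Continuity of the resolvent puts
  -- the part of the graph of T' inside U × V into the interior, which is open but need not be a
  -- rectangle.
  set N : Set (X × StrongDual ℝ X) := {w | w ∈ U ×ˢ V ∧
    ∀ q ∈ gph T', w.2 - q.2 ∈ dualityMap (q.1 - w.1) → q ∈ U ×ˢ V}
  have hNW : ∀ q ∈ gph T', q ∈ U ×ˢ V → q ∈ interior N := by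
    intro q hq hqUV
    have hnhds := (hU.prod hV).mem_nhds hqUV
    exact mem_interior_iff_mem_nhds.mpr
      (Filter.inter_mem hnhds (hmono.resolvent_mem_of_nhds hq hnhds))
  have hWUV : interior N ⊆ U ×ˢ V := interior_subset.trans fun _ hw => hw.1
  have heqW : gph T' ∩ interior N = gph T ∩ interior N := by
    rw [← Set.inter_eq_self_of_subset_right hWUV, ← Set.inter_assoc, heq, Set.inter_assoc]
  have hx' : (x, x') ∈ gph T' :=
    ((Set.ext_iff.mp heq (x, x')).mpr ⟨hx, hxU, hxV⟩).1
  refine ⟨interior N, isOpen_interior, hNW _ hx' ⟨hxU, hxV⟩, ⟨T', hT'.1, heqW⟩, ?_⟩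
  rintro S ⟨S', hS', hSS'⟩ hTS
  refine hTS.antisymm fun w hw => ?_
  obtain ⟨z, m, hm, hj⟩ := hT'.exists_resolvent hrefl hsmooth hσ w.1 w.2
  have hq : (z, m) ∈ interior N := hNW _ hm ((interior_subset hw.2).2 _ hm hj)
  have hqT : (z, m) ∈ gph T ∩ interior N := heqW ▸ ⟨hm, hq⟩
  have hqS : (z, m) ∈ gph S' := (hSS' ▸ hTS hqT : (z, m) ∈ gph S' ∩ interior N).1
  have hwS : w ∈ gph S' := (hSS' ▸ hw : w ∈ gph S' ∩ interior N).1
  -- The pairing is nonnegative by monotonicity, yet equals -‖z - w.1‖² by the resolvent relation.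
  have h1 := hS' _ hwS _ hqS
  have h2 := hj.1
  have h3 : ‖z - w.1‖ ^ 2 ≤ 0 := by
    rw [← h2, ← neg_sub w.1 z, map_neg]
    exact neg_nonpos.mpr h1
  have h4 : ‖z - w.1‖ = 0 := by nlinarith [norm_nonneg (z - w.1)]
  have h5 : z = w.1 := sub_eq_zero.mp (norm_eq_zero.mp h4)
  have h6 : w.2 = m := by
    have := norm_eq_of_mem_dualityMap hj
    rw [h4, norm_eq_zero] at this
    exact sub_eq_zero.mp this
  have h7 : w = (z, m) := Prod.ext h5.symm h6
  rwa [h7]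

/-- A maximal extension of the strongly monotone witness is monotone, hence an admissible
competitor, so it agrees with T on W. -/
theorem LocallyStronglyMaximalMonotoneA.typeB {σ : ℝ} (hσ : 0 < σ)
    {T : X → Set (StrongDual ℝ X)} {x : X} {x' : StrongDual ℝ X}
    (h : LocallyStronglyMaximalMonotoneA σ T x x') :
    LocallyStronglyMaximalMonotoneB σ T x x' := by
  obtain ⟨W, hW, hxW, ⟨T₁, hT₁, heq⟩, hmax⟩ := h
  obtain ⟨T', hT', hsub⟩ := hT₁.exists_maximal
  have key := hmax T' ⟨T', hT'.1.isMonotone hσ.le, rfl⟩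
    (heq ▸ Set.inter_subset_inter_left W hsub)
  obtain ⟨U, V, hU, hxU, hV, hxV, hUV⟩ := mem_nhds_prod_iff'.mp (hW.mem_nhds hxW)
  refine ⟨U, V, hU, hV, hxU, hxV, T', hT', ?_⟩
  rw [← Set.inter_eq_self_of_subset_right hUV, ← Set.inter_assoc, ← key, Set.inter_assoc]

theorem LocallyStronglyMaximalMonotoneARect.typeA {σ : ℝ} {T : X → Set (StrongDual ℝ X)} {x : X}
    {x' : StrongDual ℝ X} (h : LocallyStronglyMaximalMonotoneARect σ T x x') :
    LocallyStronglyMaximalMonotoneA σ T x x' := by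
  obtain ⟨U, V, hU, hV, hxU, hxV, h⟩ := h
  exact ⟨U ×ˢ V, hU.prod hV, ⟨hxU, hxV⟩, h⟩

/-! ### Localizations of the inverse -/

/-- A point monotonically related to the graph of the inverse of a continuous map defined on an
open set of functionals lies on that graph. -/
theorem eq_of_monotone_related {V : Set (StrongDual ℝ X)} (hV : IsOpen V)
    {f : StrongDual ℝ X → X} (hf : ContinuousOn f V) {x : X} {y : StrongDual ℝ X} (hy : y ∈ V)
    (h : ∀ v ∈ V, 0 ≤ (v - y) (f v - x)) : f y = x := by
  -- Minty's trick: test at v = y + tk, divide by t, and let t ↓ 0 using continuity of `f`.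
  have key : ∀ k : StrongDual ℝ X, 0 ≤ k (f y - x) := by
    intro k
    have hcont : Tendsto (fun t : ℝ => y + t • k) (𝓝[>] 0) (𝓝 y) := by
      have : Continuous fun t : ℝ => y + t • k := by fun_prop
      simpa using (this.tendsto 0).mono_left nhdsWithin_le_nhds
    have hlim : Tendsto (fun t : ℝ => k (f (y + t • k) - x)) (𝓝[>] 0) (𝓝 (k (f y - x))) :=
      (k.continuous.tendsto _).comp
        ((((hf.continuousAt (hV.mem_nhds hy)).tendsto).comp hcont).sub_const x)
    refine ge_of_tendsto hlim ?_
    filter_upwards [hcont.eventually (hV.mem_nhds hy), self_mem_nhdsWithin] with t htV ht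
    have h1 := h _ htV
    rw [add_sub_cancel_left, smul_apply, smul_eq_mul] at h1
    exact nonneg_of_mul_nonneg_right h1 ht
  refine sub_eq_zero.mp ((SeparatingDual.eq_zero_iff_forall_dual_eq_zero (R := ℝ) _).mpr
    fun k => le_antisymm ?_ (key k))
  have := key (-k)
  rw [neg_apply] at this
  linarith

theorem locallyStronglyMaximalMonotoneB_of_localization {σ : ℝ} (hσ : 0 < σ)
    {T : X → Set (StrongDual ℝ X)} {x : X} {x' : StrongDual ℝ X} (hx : (x, x') ∈ gph T)
    (h : LocallyStronglyMonotone σ T x x')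
    (hloc : HasContinuousSingleValuedLocalization (inv T) x' x) :
    LocallyStronglyMaximalMonotoneB σ T x x' := by
  obtain ⟨U, V, hU, hV, hxU, hxV, T₁, hT₁, heq⟩ := h
  obtain ⟨V', U', f, hV', hU', hxV', hxU', hf, hgph⟩ := hloc
  obtain ⟨T', hT', hsub⟩ := hT₁.exists_maximal
  have hTf : ∀ {y v}, v ∈ V' → (y = f v ↔ (y, v) ∈ gph T ∧ y ∈ U') := by
    intro y v hv
    have := Set.ext_iff.mp hgph (v, y)
    constructor
    · intro hy
      have := this.mpr ⟨hv, hy⟩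
      exact ⟨this.1, this.2.2⟩
    · intro hy
      exact (this.mp ⟨hy.1, hv, hy.2⟩).2
  have hfx : x = f x' := (hTf hxV').mpr ⟨hx, hxU'⟩
  -- Shrunk so that the whole graph of `f` over `V''` lies in the region where T is contained in T';
  -- `eq_of_monotone_related` needs all of it.
  set V'' : Set (StrongDual ℝ X) := V ∩ (V' ∩ f ⁻¹' (U ∩ U')) with hV''
  have hV''o : IsOpen V'' := hV.inter (hf.isOpen_inter_preimage hV' (hU.inter hU'))
  have hTT' : ∀ p ∈ gph T, p ∈ U ×ˢ V → p ∈ gph T' := fun p hp hpUV =>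
    hsub (heq ▸ ⟨hp, hpUV⟩ : p ∈ gph T₁ ∩ U ×ˢ V).1
  refine ⟨U ∩ U', V'', hU.inter hU', hV''o, ⟨hxU, hxU'⟩,
    ⟨hxV, hxV', by rw [Set.mem_preimage, ← hfx]; exact ⟨hxU, hxU'⟩⟩, T', hT', ?_⟩
  refine Set.Subset.antisymm ?_ ?_
  · rintro ⟨y, v⟩ ⟨hp, hpU, hpV⟩
    refine ⟨?_, hpU, hpV⟩
    have h1 : f v = y := by
      refine eq_of_monotone_related hV''o (hf.mono fun u hu => hu.2.1) hpV fun u hu => ?_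
      have h2 := (hTf hu.2.1).mp rfl
      exact hT'.1.isMonotone hσ.le _ (hTT' _ h2.1 ⟨hu.2.2.1, hu.1⟩) _ hp
    exact ((hTf hpV.2.1).mp h1.symm).1
  · rintro p ⟨hp, hpU, hpV⟩
    exact ⟨hTT' p hp ⟨hpU.1, hpV.1⟩, hpU, hpV⟩

/-! ### Strict convexity, Kadec–Klee and the continuous inverse -/

/-- The functional j forces ‖x‖ = ‖y‖ and ‖x + y‖ = ‖x‖ + ‖y‖, the equality case of the triangle
inequality. -/
theorem eq_of_mem_dualityMap_apply [StrictConvexSpace ℝ X] {x y : X} {j : StrongDual ℝ X}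
    (hj : j ∈ dualityMap x) (hy : ‖y‖ ≤ ‖x‖) (h : j y = ‖x‖ ^ 2) : x = y := by
  rcases (norm_nonneg x).eq_or_lt with h0 | h0
  · rw [← h0] at hy
    rw [norm_eq_zero.mp h0.symm, norm_le_zero_iff.mp hy]
  have h1 := apply_le_of_mem_dualityMap hj y
  have h2 := apply_le_of_mem_dualityMap hj (x + y)
  rw [map_add, hj.1, h] at h2
  have h3 : ‖x‖ = ‖y‖ := le_antisymm (by nlinarith) hy
  refine eq_of_norm_eq_of_norm_add_eq h3 (le_antisymm (norm_add_le _ _) ?_)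
  rw [← h3]
  nlinarith

/-- A sequence along which a support functional of the limiting norm sphere is asymptotically
attained converges, in a reflexive strictly convex space with the Kadec–Klee property. -/
theorem KadecKlee.tendsto_of_apply_tendsto [StrictConvexSpace ℝ X] (hK : KadecKlee X)
    (hrefl : IsReflexiveSpace X) {u : ℕ → X} {x : X} {j : StrongDual ℝ X}
    (hj : j ∈ dualityMap x) (hn : Tendsto (fun k => ‖u k‖) atTop (𝓝 ‖x‖))
    (hju : Tendsto (fun k => j (u k)) atTop (𝓝 (‖x‖ ^ 2))) : Tendsto u atTop (𝓝 x) := by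
  refine hK u x (fun f => ?_) hn
  obtain ⟨r, hr⟩ := hn.bddAbove_range
  -- Weak convergence is tested on ultrafilters: Banach–Alaoglu in the bidual and reflexivity give a
  -- weak limit y, with j y = ‖x‖² and ‖y‖ ≤ ‖x‖, so y = x.
  rw [tendsto_iff_ultrafilter]
  intro 𝒰 h𝒰
  set φ : ℕ → WeakDual ℝ (StrongDual ℝ X) := fun k =>
    StrongDual.toWeakDual (NormedSpace.inclusionInDoubleDual ℝ X (u k))
  obtain ⟨Φ, -, hΦ⟩ := (WeakDual.isCompact_closedBall (𝕜 := ℝ) (E := StrongDual ℝ X) 0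
    r).ultrafilter_le_nhds (𝒰.map φ) (by
      refine le_principal_iff.mpr (Filter.mem_map.mpr (univ_mem' fun k => ?_))
      simp only [Set.mem_preimage, mem_closedBall_zero_iff]
      exact (NormedSpace.double_dual_bound ℝ X (u k)).trans (hr ⟨k, rfl⟩))
  obtain ⟨y, hy⟩ := hrefl (WeakDual.toStrongDual Φ)
  have hlim : ∀ g : StrongDual ℝ X, Tendsto (fun k => g (u k)) 𝒰 (𝓝 (g y)) := by
    intro g
    have h1 : Tendsto (fun k => φ k g) 𝒰 (𝓝 (Φ g)) :=
      ((WeakDual.eval_continuous g).tendsto Φ).comp hΦ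
    have h2 : Φ g = g y := by
      rw [← NormedSpace.dual_def ℝ X y g, hy]; rfl
    rwa [h2] at h1
  have hjy : j y = ‖x‖ ^ 2 := tendsto_nhds_unique (hlim j) (hju.mono_left h𝒰)
  have hyn : ‖y‖ ≤ ‖x‖ := by
    obtain ⟨g, hg, hgy⟩ := exists_dual_vector'' ℝ y
    have h1 : g y ≤ ‖x‖ := by
      refine le_of_tendsto_of_tendsto' (hlim g) (hn.mono_left h𝒰) fun k => ?_
      refine (le_abs_self _).trans ((g.le_opNorm _).trans ?_)
      exact mul_le_of_le_one_left (norm_nonneg _) hg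
    simpa [hgy] using h1
  rw [eq_of_mem_dualityMap_apply hj hyn hjy]
  exact hlim f

/-- Under the additional geometric assumptions, the inverse of a strongly maximal monotone
operator is a continuous map defined on the whole dual space. -/
theorem IsStronglyMaximalMonotone.exists_continuous_inverse [StrictConvexSpace ℝ X]
    (hrefl : IsReflexiveSpace X) (hsmooth : GateauxSmooth X) (hK : KadecKlee X) {σ : ℝ}
    (hσ : 0 < σ) {T : X → Set (StrongDual ℝ X)} (hT : IsStronglyMaximalMonotone σ T) :
    ∃ f : StrongDual ℝ X → X, Continuous f ∧ ∀ z y, (z, y) ∈ gph T ↔ z = f y := by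
  choose J hJ using exists_mem_dualityMap (X := X)
  choose f hf using hT.exists_mem_gph hrefl hsmooth hσ
  have hineq : ∀ p ∈ gph T, ∀ q ∈ gph T,
      σ * ((‖p.1‖ - ‖q.1‖) ^ 2 + (‖p.1‖ * ‖q.1‖ - J q.1 p.1)) ≤
        ‖p.2 - q.2‖ * (‖p.1‖ + ‖q.1‖) := by
    intro p hp q hq
    have h1 := hT.1 p hp q hq _ (hJ _) _ (hJ _)
    rw [sub_apply_sub_of_mem_dualityMap (hJ _) (hJ _)] at h1
    have h2 : (p.2 - q.2) (p.1 - q.1) ≤ ‖p.2 - q.2‖ * (‖p.1‖ + ‖q.1‖) :=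
      (le_abs_self _).trans (((p.2 - q.2).le_opNorm _).trans
        (mul_le_mul_of_nonneg_left (norm_sub_le _ _) (norm_nonneg _)))
    have h3 := mul_nonneg hσ.le (sub_nonneg.mpr (apply_le_of_mem_dualityMap (hJ p.1) q.1))
    nlinarith
  refine ⟨f, ?_, fun z y => ⟨fun hz => ?_, fun hz => hz ▸ hf y⟩⟩
  · refine continuous_iff_seqContinuous.mpr fun v y hv => ?_
    set d : ℕ → ℝ := fun k => ‖v k - y‖ / σ with hd
    have hd0 : Tendsto d atTop (𝓝 0) := by
      have := (tendsto_iff_norm_sub_tendsto_zero.mp hv).div_const σ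
      rwa [zero_div] at this
    have hdn : ∀ k, 0 ≤ d k := fun k => by positivity
    have hk : ∀ k, (‖f (v k)‖ - ‖f y‖) ^ 2 + (‖f (v k)‖ * ‖f y‖ - J (f y) (f (v k))) ≤
        d k * (‖f (v k)‖ + ‖f y‖) := by
      intro k
      have h1 := hineq _ (hf (v k)) _ (hf y)
      have h2 : ‖v k - y‖ = σ * d k := by simp only [hd]; field_simp
      simp only [h2, mul_assoc] at h1
      exact le_of_mul_le_mul_left h1 hσ
    have hJle : ∀ k, J (f y) (f (v k)) ≤ ‖f (v k)‖ * ‖f y‖ := fun k => by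
      rw [mul_comm]; exact apply_le_of_mem_dualityMap (hJ _) _
    -- For s = |‖f (v k)‖ - ‖f y‖|, `hk` gives s² ≤ d s + 2d‖f y‖, and s² ≤ d s + e implies s ≤ d +
    -- √e.
    set b : ℕ → ℝ := fun k => d k + Real.sqrt (2 * d k * ‖f y‖) with hb
    have hb0 : Tendsto b atTop (𝓝 0) := by
      have h1 : Tendsto (fun k => Real.sqrt (2 * d k * ‖f y‖)) atTop (𝓝 0) := by
        have := ((hd0.const_mul 2).mul_const ‖f y‖).sqrt
        simpa using this
      have h2 := hd0.add h1
      rwa [add_zero] at h2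
    have habs : ∀ k, |‖f (v k)‖ - ‖f y‖| ≤ b k := by
      intro k
      have h1 : (‖f (v k)‖ - ‖f y‖) ^ 2 ≤ d k * |‖f (v k)‖ - ‖f y‖| + 2 * d k * ‖f y‖ := by
        nlinarith [hk k, hJle k, mul_le_mul_of_nonneg_left
          (le_abs_self (‖f (v k)‖ - ‖f y‖)) (hdn k)]
      have h0 : 0 ≤ 2 * d k * ‖f y‖ := mul_nonneg (mul_nonneg zero_le_two (hdn k)) (norm_nonneg _)
      have hs := Real.sq_sqrt h0
      have hsn := Real.sqrt_nonneg (2 * d k * ‖f y‖)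
      rw [← sq_abs] at h1
      by_contra hcon
      push Not at hcon
      simp only [hb] at hcon
      nlinarith [hdn k]
    have hnorm : Tendsto (fun k => ‖f (v k)‖) atTop (𝓝 ‖f y‖) := by
      rw [tendsto_iff_norm_sub_tendsto_zero]
      exact squeeze_zero (fun _ => norm_nonneg _) habs hb0
    refine hK.tendsto_of_apply_tendsto hrefl (hJ (f y)) hnorm ?_
    have hup : Tendsto (fun k => ‖f (v k)‖ * ‖f y‖) atTop (𝓝 (‖f y‖ ^ 2)) := by
      rw [pow_two]; exact hnorm.mul_const _
    have hlow : Tendsto (fun k => ‖f (v k)‖ * ‖f y‖ - d k * (‖f (v k)‖ + ‖f y‖)) atTop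
        (𝓝 (‖f y‖ ^ 2)) := by
      have := hup.sub (hd0.mul (hnorm.add_const ‖f y‖))
      simpa using this
    refine tendsto_of_tendsto_of_tendsto_of_le_of_le hlow hup (fun k => ?_) hJle
    have := hk k
    simp only [Function.comp_apply]
    nlinarith [sq_nonneg (‖f (v k)‖ - ‖f y‖)]
  · have h1 := hineq _ hz _ (hf y)
    simp only [sub_self, norm_zero, zero_mul] at h1
    have h2 : (‖z‖ - ‖f y‖) ^ 2 + (‖z‖ * ‖f y‖ - J (f y) z) ≤ 0 :=
      nonpos_of_mul_nonpos_right h1 hσ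
    have h3 := apply_le_of_mem_dualityMap (hJ (f y)) z
    have h4 : ‖z‖ = ‖f y‖ := by
      have : (‖z‖ - ‖f y‖) ^ 2 = 0 := by nlinarith [sq_nonneg (‖z‖ - ‖f y‖)]
      exact sub_eq_zero.mp (pow_eq_zero_iff two_ne_zero |>.mp this)
    refine (eq_of_mem_dualityMap_apply (hJ (f y)) h4.le ?_).symm
    rw [h4] at h2 h3
    nlinarith

theorem LocallyStronglyMaximalMonotoneB.localization [StrictConvexSpace ℝ X]
    (hrefl : IsReflexiveSpace X) (hsmooth : GateauxSmooth X) (hK : KadecKlee X) {σ : ℝ}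
    (hσ : 0 < σ) {T : X → Set (StrongDual ℝ X)} {x : X} {x' : StrongDual ℝ X}
    (hx : (x, x') ∈ gph T) (h : LocallyStronglyMaximalMonotoneB σ T x x') :
    LocallyStronglyMonotone σ T x x' ∧ HasContinuousSingleValuedLocalization (inv T) x' x := by
  obtain ⟨U, V, hU, hV, hxU, hxV, T', hT', heq⟩ := h
  refine ⟨⟨U, V, hU, hV, hxU, hxV, T', hT'.1, heq⟩, ?_⟩
  obtain ⟨f, hf, hTf⟩ := hT'.exists_continuous_inverse hrefl hsmooth hK hσ
  have hfx : x = f x' := (hTf _ _).mp ((Set.ext_iff.mp heq (x, x')).mpr ⟨hx, hxU, hxV⟩).1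
  -- Intersecting with the preimage of `U` ensures that every value of `f` on the domain stays in
  -- the rectangle where T and T' agree.
  refine ⟨V ∩ f ⁻¹' U, U, f, hV.inter (hU.preimage hf), hU, ⟨hxV, ?_⟩, hxU, hf.continuousOn, ?_⟩
  · rwa [Set.mem_preimage, ← hfx]
  · ext ⟨v, y⟩
    constructor
    · rintro ⟨hy, hv, hyU⟩
      exact ⟨hv, (hTf _ _).mp ((Set.ext_iff.mp heq (y, v)).mpr ⟨hy, hyU, hv.1⟩).1⟩
    · rintro ⟨hv, hy⟩
      simp only at hy hv
      have hyU : y ∈ U := hy ▸ hv.2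
      exact ⟨((Set.ext_iff.mp heq (y, v)).mp ⟨(hTf _ _).mpr hy, hyU, hv.1⟩).1, hv, hyU⟩

/-- Over V ∩ f⁻¹(U) the entire graph of the continuous inverse lies in the rectangle, hence in any
competitor, and Minty's argument puts each competitor point on it. -/
theorem LocallyStronglyMaximalMonotoneB.typeA_rectangle [StrictConvexSpace ℝ X]
    (hrefl : IsReflexiveSpace X) (hsmooth : GateauxSmooth X) (hK : KadecKlee X) {σ : ℝ}
    (hσ : 0 < σ) {T : X → Set (StrongDual ℝ X)} {x : X} {x' : StrongDual ℝ X}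
    (hx : (x, x') ∈ gph T) (h : LocallyStronglyMaximalMonotoneB σ T x x') :
    LocallyStronglyMaximalMonotoneARect σ T x x' := by
  obtain ⟨U, V, hU, hV, hxU, hxV, T', hT', heq⟩ := h
  obtain ⟨f, hf, hTf⟩ := hT'.exists_continuous_inverse hrefl hsmooth hK hσ
  have hfx : x = f x' := (hTf _ _).mp ((Set.ext_iff.mp heq (x, x')).mpr ⟨hx, hxU, hxV⟩).1
  have hsub : U ×ˢ (V ∩ f ⁻¹' U) ⊆ U ×ˢ V := Set.prod_mono_right Set.inter_subset_left
  have heq' : gph T' ∩ U ×ˢ (V ∩ f ⁻¹' U) = gph T ∩ U ×ˢ (V ∩ f ⁻¹' U) := by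
    rw [← Set.inter_eq_self_of_subset_right hsub, ← Set.inter_assoc, heq, Set.inter_assoc]
  have hV' : IsOpen (V ∩ f ⁻¹' U) := hV.inter (hU.preimage hf)
  refine ⟨U, V ∩ f ⁻¹' U, hU, hV', hxU, ⟨hxV, by rwa [Set.mem_preimage, ← hfx]⟩,
    ⟨T', hT'.1, heq'⟩, ?_⟩
  rintro S ⟨S', hS', hSS'⟩ hTS
  refine hTS.antisymm fun w hw => ?_
  rw [← hSS'] at hTS
  have hwS : w ∈ gph S' := (hSS' ▸ hw : w ∈ gph S' ∩ U ×ˢ (V ∩ f ⁻¹' U)).1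
  have h1 : f w.2 = w.1 := by
    refine eq_of_monotone_related hV' hf.continuousOn hw.2.2 fun v hv => ?_
    have h2 : (f v, v) ∈ gph T ∩ U ×ˢ (V ∩ f ⁻¹' U) :=
      heq' ▸ ⟨(hTf _ _).mpr rfl, hv.2, hv⟩
    exact hS' _ (hTS h2).1 _ hwS
  exact heq' ▸ ⟨(hTf w.1 w.2).mpr h1.symm, hw.2⟩

end LocMono

theorem mainTheorem4 {X : Type*} [NormedAddCommGroup X] [NormedSpace ℝ X] [CompleteSpace X]
    (hrefl : LocMono.IsReflexiveSpace X) (hsmooth : LocMono.GateauxSmooth X)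
    (T : X → Set (StrongDual ℝ X)) (x : X) (x' : StrongDual ℝ X) (hx : (x, x') ∈ LocMono.gph T)
    (σ : ℝ) (hσ : 0 < σ) :
    (LocMono.LocallyStronglyMaximalMonotoneB σ T x x' ↔
      LocMono.LocallyStronglyMaximalMonotoneA σ T x x') ∧
    (LocMono.LocallyStronglyMaximalMonotoneARect σ T x x' →
      LocMono.LocallyStronglyMaximalMonotoneB σ T x x') ∧
    (LocMono.FrechetSmooth X → StrictConvexSpace ℝ X → LocMono.KadecKlee X →
      (LocMono.LocallyStronglyMaximalMonotoneB σ T x x' ↔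
        LocMono.LocallyStronglyMonotone σ T x x' ∧
          LocMono.HasContinuousSingleValuedLocalization (LocMono.inv T) x' x) ∧
      (LocMono.LocallyStronglyMaximalMonotoneB σ T x x' ↔
        LocMono.LocallyStronglyMaximalMonotoneARect σ T x x')) := by
  refine ⟨⟨fun h => h.typeA hrefl hsmooth hσ hx, fun h => h.typeB hσ⟩, fun h => h.typeA.typeB hσ,
    fun _ _ hK => ⟨⟨fun h => h.localization hrefl hsmooth hK hσ hx, fun h => ?_⟩,
      ⟨fun h => h.typeA_rectangle hrefl hsmooth hK hσ hx, fun h => h.typeA.typeB hσ⟩⟩⟩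
  exact LocMono.locallyStronglyMaximalMonotoneB_of_localization hσ hx h.1 h.2
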